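/- For graphs $T$ and $H$ without isolated vertices and a positive integer $n$, let $\mathrm{ex}(n,T,H)$ denote the maximum number of copies of $T$ (that is, subgraphs isomorphic to $T$) in an $n$-vertex simple graph that contains no (not necessarily induced) subgraph isomorphic to $H$. Let $K_3$ be the triangle, let $C_{2k}$ be the cycle of length $2k$, and let $\widehat{C}_{2k}$ be the suspension of $C_{2k}$, i.e. the graph obtained from $C_{2k}$ by adding a new vertex adjacent to every vertex of $C_{2k}$. Then for every fixed integer $k\ge 2$, as $n\to\infty$, \[ \mathrm{ex}(n,K_3,\widehat{C}_{2k}) = o\!\left(n^{2+\frac1k}\right). \] -/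

import Mathlib

open Filter Asymptotics

namespace SimpleGraph

/-- The suspension `K₁ ∨ H` of a graph `H`: a new vertex `none` is added to `H` and joined to every
vertex of `H`. -/
def suspension {V : Type*} (H : SimpleGraph V) : SimpleGraph (Option V) where
  Adj
    | none, none => False
    | none, some _ => True
    | some _, none => True
    | some u, some v => H.Adj u v
  symm := ⟨by
    rintro (_ | u) (_ | v) h
    · exact h
    · trivial
    · trivial
    · exact H.adj_symm h⟩
  loopless := ⟨by
    rintro (_ | u) h
    · exact h
    · exact H.irrefl h⟩

open scoped Classical in
/-- The generalized Turán number `ex(n, T, H)`: the maximum number of (unlabelled, not necessarily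
induced) copies of `T` in an `n`-vertex graph that has no (not necessarily induced) subgraph
isomorphic to `H`. -/
noncomputable def generalizedTuranNumber (n : ℕ) {U W : Type*} (T : SimpleGraph U)
    (H : SimpleGraph W) : ℕ :=
  Finset.sup {G : SimpleGraph (Fin n) | H.Free G} (fun G => G.copyCount T)

end SimpleGraph

/-! In a graph with no suspended `2k`-cycle every link is `C_{2k}`-free, and triangles are edges of
links. The Bondy–Simonovits bound, refined to count the link edges meeting a set `S` by `O(k n
|S|^(1/k))` (`sum_card_neighbors_le_of_free_cycleGraph`), with `S` everything gives `O(n^(2+1/k)) =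
o(n^3)` triangles.

Triangle removal then destroys all triangles by deleting `o(n^2)` edges. Every triangle contains a
deleted edge, so if `F a` is the set of deleted neighbours of `a`, there are at most `O(n) * ∑ a, |F
a|^(1/k)` triangles. Since `∑ a, |F a| = o(n^2)`, the power mean inequality makes this
`o(n^(2+1/k))`.

Bondy–Simonovits itself comes from breadth-first layers: a dense core within one layer or between
two consecutive ones yields a `2k`-cycle (`cycleGraph_isContained_of_layered`), so under large
minimum degree the spheres grow geometrically until they outnumber the vertices. -/

namespace SimpleGraph

open Finset

variable {V : Type*}

/-! ### Degree cores and greedy paths -/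

open scoped Classical in
/-- Either a symmetric relation on `S` has a nonempty part of minimum degree greater than `K`,
or its average degree is at most `2 * K`. -/
theorem exists_core_or_sum_le {r : V → V → Prop} (hr : ∀ a b, r a b → r b a) (K : ℕ)
    (S : Finset V) :
    (∃ S' ⊆ S, S'.Nonempty ∧ ∀ v ∈ S', K < #{w ∈ S' | r v w}) ∨
      ∑ v ∈ S, #{w ∈ S | r v w} ≤ 2 * K * #S := by
  induction hn : #S generalizing S with
  | zero => right; simp_all
  | succ n ih =>
    by_cases h : ∀ v ∈ S, K < #{w ∈ S | r v w}
    · exact .inl ⟨S, Subset.rfl, card_pos.1 (by omega), h⟩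
    push Not at h
    obtain ⟨v, hv, hvK⟩ := h
    have hcard : #(S.erase v) = n := by rw [card_erase_of_mem hv]; omega
    rcases ih (S.erase v) hcard with ⟨S', hS', h⟩ | h
    · exact .inl ⟨S', hS'.trans (erase_subset _ _), h⟩
    right
    -- By symmetry, `v` contributes its own degree and one to each neighbour's degree; both totals
    -- are at most `K`.
    have h1 : ∀ w ∈ S.erase v, #{u ∈ S | r w u} ≤
        #{u ∈ S.erase v | r w u} + if r v w then 1 else 0 := by
      intro w _
      split_ifs with hw
      · rw [← insert_erase hv, filter_insert]
        split_ifs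
        · exact (card_insert_le _ _).trans (by simp)
        · simp
      · rw [← insert_erase hv, filter_insert, if_neg (fun h' => hw (hr _ _ h'))]
        simp
    have h2 : #{w ∈ S.erase v | r v w} ≤ K :=
      (card_le_card (filter_subset_filter _ (erase_subset _ _))).trans hvK
    rw [← add_sum_erase _ _ hv]
    have h3 := sum_le_sum h1
    rw [sum_add_distrib, ← card_filter] at h3
    nlinarith

open scoped Classical in
/-- In a graph where the vertices of `A` have many neighbours in `B` and conversely, one can
greedily build an alternating path of length `n` that avoids a small set `X`. -/
theorem exists_alternating_path {G : SimpleGraph V} {K : ℕ} (n : ℕ) (A B X : Finset V)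
    (hA : ∀ a ∈ A, K < #{b ∈ B | G.Adj a b}) (hB : ∀ b ∈ B, K < #{a ∈ A | G.Adj b a})
    (hK : n + #X ≤ K) {a : V} (ha : a ∈ A) (haX : a ∉ X) :
    ∃ w : ℕ → V, w 0 = a ∧ (∀ j ≤ n, w j ∉ X) ∧ Set.InjOn w (Set.Iic n) ∧
      (∀ j < n, G.Adj (w j) (w (j + 1))) ∧
      ∀ j ≤ n, w j ∈ if Even j then A else B := by
  induction n generalizing A B X a with
  | zero =>
    refine ⟨fun _ => a, rfl, fun _ _ => haX, ?_, by simp, ?_⟩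
    · intro i hi j hj _
      simp at hi hj
      omega
    · intro j hj
      obtain rfl : j = 0 := by omega
      simpa
  | succ n ih =>
    have hcard : #(insert a X) < #{b ∈ B | G.Adj a b} := by
      have := hA a ha
      have := card_insert_le a X
      omega
    obtain ⟨b, hb, hbX⟩ := exists_mem_notMem_of_card_lt_card hcard
    rw [mem_filter] at hb
    -- The sides swap, and forbidding `a` keeps the path injective; the sum of length and forbidden
    -- size does not grow.
    obtain ⟨w, hw0, hwX, hwi, hwa, hwm⟩ := ih B A (insert a X) hB hA
      (by have := card_insert_le a X; omega) hb.1 hbX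
    obtain ⟨W, hW0, hW⟩ : ∃ W : ℕ → V, W 0 = a ∧ ∀ j, W (j + 1) = w j :=
      ⟨fun j => j.casesOn a w, rfl, fun _ => rfl⟩
    refine ⟨W, hW0, ?_, ?_, ?_, ?_⟩
    · rintro (_ | j) hj
      · exact hW0 ▸ haX
      · exact fun h => hwX j (by omega) (hW j ▸ mem_insert_of_mem h)
    · rintro (_ | i) hi (_ | j) hj h
      · rfl
      · rw [hW0, hW] at h
        exact absurd (h ▸ mem_insert_self a X) (hwX j (by simpa using hj))
      · rw [hW0, hW] at h
        exact absurd (h ▸ mem_insert_self a X) (hwX i (by simpa using hi))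
      · simp only [Set.mem_Iic, add_le_add_iff_right] at hi hj
        rw [hW, hW] at h
        rw [hwi hi hj h]
    · rintro (_ | j) hj
      · rw [hW0, hW, hw0]; exact hb.2
      · rw [hW, hW]; exact hwa j (by omega)
    · rintro (_ | j) hj
      · simpa [hW0]
      · have := hwm j (by omega)
        rw [hW]
        simp only [Nat.even_add_one]
        split_ifs at this ⊢ <;> simp_all

/-! ### Even cycles from layers and parent chains -/

theorem cycleGraph_isContained_of_injOn {G : SimpleGraph V} {N : ℕ} (hN : 3 ≤ N) (f : ℕ → V)
    (hf : Set.InjOn f (Set.Iio N)) (hadj : ∀ j, j + 1 < N → G.Adj (f j) (f (j + 1)))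
    (hlast : G.Adj (f (N - 1)) (f 0)) : cycleGraph N ⊑ G := by
  have key : ∀ a b : Fin N, (b : ℕ) = (a + 1) % N → G.Adj (f a) (f b) := by
    intro a b hab
    rcases Nat.lt_or_ge (a + 1) N with h | h
    · rw [hab, Nat.mod_eq_of_lt h]; exact hadj _ h
    · have ha : (a : ℕ) = N - 1 := by omega
      rw [hab, ha, show N - 1 + 1 = N by omega, Nat.mod_self]; exact hlast
  refine ⟨⟨⟨fun a => f a, ?_⟩, ?_⟩⟩
  · intro a b hab
    obtain ⟨M, rfl⟩ : ∃ M, N = M + 2 := ⟨N - 2, by omega⟩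
    rw [cycleGraph_adj] at hab
    rcases hab with h | h
    · refine (key b a ?_).symm
      rw [sub_eq_iff_eq_add] at h
      rw [h, Fin.val_add, Fin.val_one, add_comm]
    · refine key a b ?_
      rw [sub_eq_iff_eq_add] at h
      rw [h, Fin.val_add, Fin.val_one, add_comm]
  · intro a b hab
    exact Fin.ext (hf (by simp) (by simp) hab)

theorem layer_iterate {L : V → ℕ} {p : V → V} (hp : ∀ v, 0 < L v → L (p v) + 1 = L v)
    (v : V) : ∀ t ≤ L v, L (p^[t] v) + t = L v := by
  intro t
  induction t with
  | zero => simp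
  | succ t ih =>
    intro ht
    have h1 := ih (by omega)
    have h2 := hp (p^[t] v) (by omega)
    rw [Function.iterate_succ_apply']
    omega

/-- Closing up a path between two vertices of the same layer through the two parent chains, which
meet after exactly `h` steps. -/
theorem cycleGraph_isContained_of_path_of_chains {G : SimpleGraph V} {L : V → ℕ} {p : V → V}
    (hp : ∀ v, 0 < L v → G.Adj v (p v) ∧ L (p v) + 1 = L v) {i h m : ℕ} (hh : h + 1 ≤ i)
    (hm : 1 ≤ m) (w : ℕ → V) (hwi : Set.InjOn w (Set.Iic (2 * m)))
    (hwa : ∀ j < 2 * m, G.Adj (w j) (w (j + 1))) (hwL : ∀ j ≤ 2 * m, i ≤ L (w j))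
    (h0 : L (w 0) = i) (h2 : L (w (2 * m)) = i)
    (hne : p^[h] (w 0) ≠ p^[h] (w (2 * m)))
    (heq : p^[h + 1] (w 0) = p^[h + 1] (w (2 * m))) :
    cycleGraph (2 * (m + (h + 1))) ⊑ G := by
  have hL := fun v => layer_iterate (fun v hv => (hp v hv).2) v
  have hadj : ∀ v, ∀ t < L v, G.Adj (p^[t] v) (p^[t + 1] v) := by
    intro v t ht
    rw [Function.iterate_succ_apply']
    exact (hp _ (by have := hL v t ht.le; omega)).1
  have hne' : ∀ t ≤ h, p^[t] (w 0) ≠ p^[t] (w (2 * m)) := by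
    intro t ht he
    apply hne
    rw [show h = (h - t) + t by omega, Function.iterate_add_apply, he,
      ← Function.iterate_add_apply]
  -- Follow `w`, descend from its end to the common ancestor, then climb back to `w 0`. The chains
  -- lie strictly below layer `i` after their first vertex, hence off the path.
  set f : ℕ → V := fun j => if j ≤ 2 * m then w j else
    if j ≤ 2 * m + (h + 1) then p^[j - 2 * m] (w (2 * m))
    else p^[2 * (m + (h + 1)) - j] (w 0) with hf
  have f1 : ∀ j ≤ 2 * m, f j = w j := fun j hj => by simp [hf, hj]
  have f2 : ∀ t ≤ h + 1, f (2 * m + t) = p^[t] (w (2 * m)) := by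
    intro t ht
    rcases t with _ | t
    · simp [hf]
    · simp [hf, ht]
  have f3 : ∀ t ≤ h + 1, 0 < t → f (2 * (m + (h + 1)) - t) = p^[t] (w 0) := by
    intro t ht ht'
    rcases eq_or_lt_of_le ht with rfl | ht
    · rw [heq, ← f2 _ le_rfl]; congr 1; omega
    · simp only [hf]
      rw [if_neg (by omega), if_neg (by omega)]; congr 1; omega
  have cases : ∀ j < 2 * (m + (h + 1)), j ≤ 2 * m ∨ (∃ t, 0 < t ∧ t ≤ h + 1 ∧ j = 2 * m + t) ∨
      ∃ t, 0 < t ∧ t ≤ h ∧ j = 2 * (m + (h + 1)) - t := by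
    intro j hj
    by_cases h1 : j ≤ 2 * m
    · exact .inl h1
    by_cases h2 : j ≤ 2 * m + (h + 1)
    · exact .inr (.inl ⟨j - 2 * m, by omega⟩)
    · exact .inr (.inr ⟨2 * (m + (h + 1)) - j, by omega⟩)
  apply cycleGraph_isContained_of_injOn (by omega) f
  · intro a ha b hb hab
    wlog hle : a ≤ b generalizing a b
    · exact (this hb ha hab.symm (by omega)).symm
    rcases cases a ha with h1 | ⟨t, ht0, ht, rfl⟩ | ⟨t, ht0, ht, rfl⟩ <;>
    rcases cases b hb with h1' | ⟨s, hs0, hs, rfl⟩ | ⟨s, hs0, hs, rfl⟩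
    · rw [f1 _ h1, f1 _ h1'] at hab
      exact hwi h1 h1' hab
    · rw [f1 _ h1, f2 _ hs] at hab
      have := hwL a h1
      have := hL (w (2 * m)) s (by omega)
      rw [← hab] at this
      omega
    · rw [f1 _ h1, f3 _ (by omega) hs0] at hab
      have := hwL a h1
      have := hL (w 0) s (by omega)
      rw [← hab] at this
      omega
    · omega
    · rw [f2 _ ht, f2 _ hs] at hab
      have h3 := hL (w (2 * m)) s (by omega)
      have h4 := hL (w (2 * m)) t (by omega)
      rw [hab] at h4
      omega
    · rw [f2 _ ht, f3 _ (by omega) hs0] at hab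
      have h3 := hL (w 0) s (by omega)
      have h4 := hL (w (2 * m)) t (by omega)
      rw [hab] at h4
      obtain rfl : s = t := by omega
      exact absurd hab.symm (hne' _ hs)
    · omega
    · omega
    · rw [f3 _ (by omega) ht0, f3 _ (by omega) hs0] at hab
      have h3 := hL (w 0) s (by omega)
      have h4 := hL (w 0) t (by omega)
      rw [hab] at h4
      omega
  · intro j hj
    rcases cases j (by omega) with h1 | ⟨t, ht0, ht, rfl⟩ | ⟨t, ht0, ht, rfl⟩
    · rcases eq_or_lt_of_le h1 with rfl | h1
      · rw [f1 _ le_rfl, f2 1 (by omega)]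
        exact hadj _ 0 (by omega)
      · rw [f1 _ h1.le, f1 _ h1]
        exact hwa j h1
    · rcases eq_or_lt_of_le ht with rfl | ht
      · rw [f2 _ le_rfl, ← heq,
          show 2 * m + (h + 1) + 1 = 2 * (m + (h + 1)) - h by omega, f3 _ (by omega) (by omega)]
        exact (hadj _ _ (by omega)).symm
      · rw [f2 _ ht.le, add_assoc, f2 _ ht]
        exact hadj _ _ (by omega)
    · rw [f3 _ (by omega) ht0, show 2 * (m + (h + 1)) - t + 1 = 2 * (m + (h + 1)) - (t - 1) by omega,
        f3 _ (by omega) (by omega)]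
      have := hadj (w 0) (t - 1) (by omega)
      rw [show t - 1 + 1 = t by omega] at this
      exact this.symm
  · rw [f1 0 (by omega), f3 1 (by omega) (by omega)]
    exact (hadj (w 0) 0 (by omega)).symm

-- Take the least `h + 1` such that `Y`-neighbours of a common `z` always share their `(h + 1)`-th
-- ancestor. Some `z` has neighbours `u`, `v` with distinct `h`-th ancestors. A path of odd length
-- from `z` ends in `Y`, and its end disagrees at level `h` with `u` or `v`; prepending that one
-- gives a path whose two parent chains meet after exactly `h + 1` steps. The path length is free,
-- so the cycle can be given length `2k`. `Y` and `Z` may overlap or coincide.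
open scoped Classical in
theorem cycleGraph_isContained_of_layered {G : SimpleGraph V} {k i : ℕ} (hi : i < k)
    {L : V → ℕ} {p : V → V} {x : V} (hp : ∀ v, 0 < L v → G.Adj v (p v) ∧ L (p v) + 1 = L v)
    {Y Z : Finset V} (hYne : Y.Nonempty) (hYL : ∀ y ∈ Y, L y = i) (hYx : ∀ y ∈ Y, p^[i] y = x)
    (hZL : ∀ z ∈ Z, i ≤ L z) (hY : ∀ y ∈ Y, 2 * k < #{z ∈ Z | G.Adj y z})
    (hZ : ∀ z ∈ Z, 2 * k < #{y ∈ Y | G.Adj z y}) : cycleGraph (2 * k) ⊑ G := by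
  set Q : ℕ → Prop := fun t => ∀ z ∈ Z, ∀ u ∈ Y, ∀ v ∈ Y, G.Adj z u → G.Adj z v →
    p^[t] u = p^[t] v with hQ
  have hex : ∃ t, Q t := ⟨i, fun z _ u hu v hv _ _ => by rw [hYx u hu, hYx v hv]⟩
  have hmin : Nat.find hex ≤ i :=
    Nat.find_min' hex fun z _ u hu v hv _ _ => by rw [hYx u hu, hYx v hv]
  have hspec := Nat.find_spec hex
  have hpos : Nat.find hex ≠ 0 := by
    intro h0
    obtain ⟨y, hy⟩ := hYne
    obtain ⟨z, hz⟩ := card_pos.1 ((Nat.zero_le _).trans_lt (hY y hy))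
    rw [mem_filter] at hz
    obtain ⟨u, hu, v, hv, huv⟩ := one_lt_card.1 (lt_of_le_of_lt (by omega) (hZ z hz.1))
    rw [mem_filter] at hu hv
    rw [h0] at hspec
    exact huv (hspec z hz.1 u hu.1 v hv.1 hu.2 hv.2)
  obtain ⟨h, hh⟩ := Nat.exists_eq_succ_of_ne_zero hpos
  have hnot : ¬ Q h := Nat.find_min hex (by omega)
  rw [hh] at hspec
  simp only [hQ] at hnot
  push Not at hnot
  obtain ⟨z, hz, u, hu, v, hv, hzu, hzv, huv⟩ := hnot
  obtain ⟨m, hm⟩ : ∃ m, k = m + (h + 1) := ⟨k - (h + 1), by omega⟩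
  by_cases hzX : z ∈ ({u, v} : Finset V)
  · simp only [mem_insert, mem_singleton] at hzX
    rcases hzX with rfl | rfl
    · exact absurd hzu (G.irrefl)
    · exact absurd hzv (G.irrefl)
  -- Since `m < k`, length `2m - 1` plus two forbidden vertices fits within `2k`.
  obtain ⟨w, hw0, hwX, hwi, hwa, hwm⟩ := exists_alternating_path (2 * m - 1) Z Y {u, v} hZ hY
    (by have := card_insert_le u {v}; rw [card_singleton] at this; omega) hz hzX
  have hwodd : ∀ j, 2 * j + 1 ≤ 2 * m - 1 → w (2 * j + 1) ∈ Y ∧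
      p^[h + 1] (w (2 * j + 1)) = p^[h + 1] u := by
    intro j
    induction j with
    | zero =>
      intro hj
      have h1 := hwm 1 hj
      simp only [Nat.not_even_one, if_false] at h1
      exact ⟨h1, hspec z hz _ h1 _ hu (hw0 ▸ hwa 0 (by omega)) hzu⟩
    | succ j ih =>
      intro hj
      obtain ⟨hjY, hju⟩ := ih (by omega)
      have h1 := hwm (2 * (j + 1) + 1) hj
      have h2 := hwm (2 * (j + 1)) (by omega)
      rw [if_neg (by simp)] at h1
      rw [if_pos (by simp)] at h2
      refine ⟨h1, ?_⟩
      rw [← hju]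
      exact hspec _ h2 _ h1 _ hjY (hwa _ (by omega)) (hwa (2 * j + 1) (by omega)).symm
  have hwLi : ∀ j ≤ 2 * m - 1, i ≤ L (w j) := by
    intro j hj
    have := hwm j hj
    split_ifs at this
    · exact hZL _ this
    · exact (hYL _ this).ge
  obtain ⟨hyY, hyu⟩ := hwodd (m - 1) (by omega)
  rw [show 2 * (m - 1) + 1 = 2 * m - 1 by omega] at hyY hyu
  have main : ∀ u' ∈ Y, G.Adj z u' → u' ∈ ({u, v} : Finset V) →
      p^[h] u' ≠ p^[h] (w (2 * m - 1)) → cycleGraph (2 * k) ⊑ G := by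
    intro u' hu' hzu' hu'X hne
    have hyu' : p^[h + 1] u' = p^[h + 1] (w (2 * m - 1)) := by
      rw [hyu]; exact hspec z hz _ hu' _ hu hzu' hzu
    rw [hm]
    obtain ⟨W, hW0, hW⟩ : ∃ W : ℕ → V, W 0 = u' ∧ ∀ j, W (j + 1) = w j :=
      ⟨fun j => j.casesOn u' w, rfl, fun _ => rfl⟩
    have e : W (2 * m) = w (2 * m - 1) := by rw [← hW]; congr 1; omega
    refine cycleGraph_isContained_of_path_of_chains hp (i := i) (by omega) (by omega)
      W ?_ ?_ ?_ (hW0 ▸ hYL _ hu') (e ▸ hYL _ hyY) (by rwa [hW0, e]) (by rwa [hW0, e])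
    · rintro (_ | a) ha (_ | b) hb hab
      · rfl
      · rw [hW0, hW] at hab
        exact absurd (hab ▸ hu'X) (hwX b (by simp at hb; omega))
      · rw [hW0, hW] at hab
        exact absurd (hab ▸ hu'X) (hwX a (by simp at ha; omega))
      · simp only [Set.mem_Iic] at ha hb
        rw [hW, hW] at hab
        rw [hwi (by simp; omega) (by simp; omega) hab]
    · rintro (_ | j) hj
      · rw [hW0, hW, hw0]; exact hzu'.symm
      · rw [hW, hW]; exact hwa j (by omega)
    · rintro (_ | j) hj
      · rw [hW0]; exact (hYL _ hu').ge
      · rw [hW]; exact hwLi j (by omega)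
  by_cases hc : p^[h] u = p^[h] (w (2 * m - 1))
  · exact main v hv hzv (by simp) (fun hc' => huv (hc.trans hc'.symm))
  · exact main u hu hzu (by simp) hc

/-! ### Growth of spheres -/

open scoped Classical in
/-- The vertices at distance `i` from `x`. -/
noncomputable def sphere [Fintype V] (G : SimpleGraph V) (x : V) (i : ℕ) : Finset V :=
  {v | G.Reachable x v ∧ G.dist x v = i}

theorem mem_sphere [Fintype V] {G : SimpleGraph V} {x v : V} {i : ℕ} :
    v ∈ G.sphere x i ↔ G.Reachable x v ∧ G.dist x v = i := by
  simp [sphere]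

theorem exists_adj_dist_add_one (G : SimpleGraph V) (x v : V) (h : 0 < G.dist x v) :
    ∃ u, G.Adj v u ∧ G.dist x u + 1 = G.dist x v := by
  obtain ⟨w, hw⟩ := (Reachable.of_dist_ne_zero h.ne').symm.exists_walk_length_eq_dist
  rw [dist_comm] at hw
  cases w with
  | nil => simp at h
  | @cons _ u _ hadj q =>
    refine ⟨u, hadj, ?_⟩
    have h1 := G.dist_le q
    rw [dist_comm] at h1
    have h2 := hadj.diff_dist_adj (u := x)
    rw [Walk.length_cons] at hw
    omega

theorem exists_parent (G : SimpleGraph V) (x : V) :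
    ∃ p : V → V, (∀ v, 0 < G.dist x v → G.Adj v (p v) ∧ G.dist x (p v) + 1 = G.dist x v) ∧
      ∀ i v, G.Reachable x v → G.dist x v = i → p^[i] v = x := by
  choose! p hp using G.exists_adj_dist_add_one x
  refine ⟨p, hp, fun i => ?_⟩
  induction i with
  | zero =>
    intro v hv h
    exact (hv.dist_eq_zero_iff.1 h).symm
  | succ i ih =>
    intro v hv h
    rw [Function.iterate_succ_apply]
    have := hp v (by omega)
    exact ih _ (hv.trans this.1.reachable) (by omega)

open scoped Classical in
theorem sum_sphere_le [Fintype V] {G : SimpleGraph V} {k : ℕ} (hG : (cycleGraph (2 * k)).Free G)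
    (x : V) {i : ℕ} (hi : i < k) :
    ∑ v ∈ G.sphere x i, #{w ∈ G.sphere x i | G.Adj v w} ≤ 2 * (2 * k) * #(G.sphere x i) := by
  obtain ⟨p, hp, hpx⟩ := G.exists_parent x
  refine (exists_core_or_sum_le (r := G.Adj) (fun _ _ h => h.symm) (2 * k) (G.sphere x i)).resolve_left ?_
  rintro ⟨S, hS, hne, hdeg⟩
  have hS' := fun v (hv : v ∈ S) => mem_sphere.1 (hS hv)
  exact hG (cycleGraph_isContained_of_layered hi hp hne (fun y hy => (hS' y hy).2)
    (fun y hy => hpx i y (hS' y hy).1 (hS' y hy).2) (fun y hy => (hS' y hy).2.ge) hdeg hdeg)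

open scoped Classical in
theorem sum_sphere_succ_le [Fintype V] {G : SimpleGraph V} {k : ℕ}
    (hG : (cycleGraph (2 * k)).Free G) (x : V) {i : ℕ} (hi : i < k) :
    ∑ v ∈ G.sphere x i, #{w ∈ G.sphere x (i + 1) | G.Adj v w} +
      ∑ v ∈ G.sphere x (i + 1), #{w ∈ G.sphere x i | G.Adj v w} ≤
      2 * (2 * k) * (#(G.sphere x i) + #(G.sphere x (i + 1))) := by
  obtain ⟨p, hp, hpx⟩ := G.exists_parent x
  have hdisj : Disjoint (G.sphere x i) (G.sphere x (i + 1)) := by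
    rw [Finset.disjoint_left]
    intro v h1 h2
    rw [mem_sphere] at h1 h2
    omega
  have hmem : ∀ v ∈ G.sphere x i ∪ G.sphere x (i + 1), G.Reachable x v ∧
      (G.dist x v = i ∨ G.dist x v = i + 1) := by
    intro v hv
    rw [mem_union, mem_sphere, mem_sphere] at hv
    tauto
  -- Discarding edges inside a layer makes the core bipartite between the two spheres.
  obtain ⟨r, hr⟩ : ∃ r : V → V → Prop, ∀ a b, r a b ↔ G.Adj a b ∧ G.dist x a ≠ G.dist x b :=
    ⟨_, fun _ _ => Iff.rfl⟩
  have hsum : ∑ v ∈ G.sphere x i ∪ G.sphere x (i + 1),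
      #{w ∈ G.sphere x i ∪ G.sphere x (i + 1) | r v w} ≤
      2 * (2 * k) * #(G.sphere x i ∪ G.sphere x (i + 1)) := by
    refine (exists_core_or_sum_le (r := r) (fun a b h => by
      rw [hr] at h ⊢; exact ⟨h.1.symm, h.2.symm⟩) (2 * k)
      (G.sphere x i ∪ G.sphere x (i + 1))).resolve_left ?_
    rintro ⟨S, hS, hne, hdeg⟩
    have hSm := fun v hv => hmem v (hS hv)
    have hY : ∀ v ∈ {v ∈ S | G.dist x v = i},
        2 * k < #{w ∈ {v ∈ S | G.dist x v = i + 1} | G.Adj v w} := by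
      intro v hv
      rw [mem_filter] at hv
      refine (hdeg v hv.1).trans_le (card_le_card fun w hw => ?_)
      simp only [mem_filter, hr] at hw ⊢
      have := hSm w hw.1
      exact ⟨⟨hw.1, by omega⟩, hw.2.1⟩
    have hZ : ∀ v ∈ {v ∈ S | G.dist x v = i + 1},
        2 * k < #{w ∈ {v ∈ S | G.dist x v = i} | G.Adj v w} := by
      intro v hv
      rw [mem_filter] at hv
      refine (hdeg v hv.1).trans_le (card_le_card fun w hw => ?_)
      simp only [mem_filter, hr] at hw ⊢
      have := hSm w hw.1
      exact ⟨⟨hw.1, by omega⟩, hw.2.1⟩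
    have hYne : ({v ∈ S | G.dist x v = i} : Finset V).Nonempty := by
      obtain ⟨v, hv⟩ := hne
      rcases (hSm v hv).2 with h | h
      · exact ⟨v, mem_filter.2 ⟨hv, h⟩⟩
      · obtain ⟨w, hw⟩ := card_pos.1 ((Nat.zero_le _).trans_lt (hZ v (mem_filter.2 ⟨hv, h⟩)))
        exact ⟨w, (mem_filter.1 hw).1⟩
    refine hG (cycleGraph_isContained_of_layered hi hp hYne (fun y hy => (mem_filter.1 hy).2)
      (fun y hy => hpx i y (hSm y (mem_filter.1 hy).1).1 (mem_filter.1 hy).2)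
      (fun z hz => ?_) hY hZ)
    have := (mem_filter.1 hz).2
    omega
  rw [sum_union hdisj, card_union_of_disjoint hdisj] at hsum
  refine (add_le_add (sum_le_sum fun v hv => card_le_card fun w hw => ?_)
    (sum_le_sum fun v hv => card_le_card fun w hw => ?_)).trans hsum
  all_goals
    rw [mem_filter] at hw
    have h1 := (mem_sphere.1 hw.1).2
    have h2 := (mem_sphere.1 hv).2
    rw [mem_filter, mem_union]
    exact ⟨by tauto, (hr _ _).2 ⟨hw.2, by omega⟩⟩

open scoped Classical in
/-- In a graph without a `2k`-cycle of large minimum degree, the first `k` spheres around any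
vertex grow by a factor `M`. -/
theorem mul_card_sphere_le [Fintype V] {G : SimpleGraph V} {k : ℕ} {M : ℕ} (hM : 1 ≤ M)
    (hk : 1 ≤ k) (hG : (cycleGraph (2 * k)).Free G)
    (hdeg : ∀ v, 2 * (2 * k) * (M + 4) ≤ #{w | G.Adj v w}) (x : V) (i : ℕ) (hi : i < k) :
    M * #(G.sphere x i) ≤ #(G.sphere x (i + 1)) := by
  induction i with
  | zero =>
    have h0 : G.sphere x 0 = {x} := by
      ext v
      rw [mem_sphere, mem_singleton]
      constructor
      · rintro ⟨h, h'⟩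
        exact (h.dist_eq_zero_iff.1 h').symm
      · rintro rfl
        simp
    have h1 : #{w | G.Adj x w} ≤ #(G.sphere x 1) := by
      refine card_le_card fun w hw => ?_
      have hw := (mem_filter.1 hw).2
      exact mem_sphere.2 ⟨hw.reachable, dist_eq_one_iff_adj.2 hw⟩
    rw [h0, card_singleton]
    have := hdeg x
    simp only [zero_add]
    nlinarith
  | succ i ih =>
    have ih := ih (by omega)
    have h1 := sum_sphere_le hG x hi
    have h2 := sum_sphere_succ_le hG x hi
    have h3 := sum_sphere_succ_le hG x (show i < k by omega)
    have h4 : #(G.sphere x (i + 1)) * (2 * (2 * k) * (M + 4)) ≤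
        ∑ v ∈ G.sphere x (i + 1), (#{w ∈ G.sphere x i | G.Adj v w} +
          #{w ∈ G.sphere x (i + 1) | G.Adj v w} + #{w ∈ G.sphere x (i + 1 + 1) | G.Adj v w}) := by
      rw [← smul_eq_mul]
      refine card_nsmul_le_sum _ _ _ fun v hv => (hdeg v).trans ?_
      refine (card_le_card fun w hw => ?_).trans
        ((card_union_le _ _).trans (Nat.add_le_add_right (card_union_le _ _) _))
      have hw := (mem_filter.1 hw).2
      rw [mem_sphere] at hv
      have h5 := hw.diff_dist_adj (u := x)
      have h6 := hv.1.trans hw.reachable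
      simp only [mem_union, mem_filter, mem_sphere, hw, h6, true_and, and_true]
      omega
    rw [sum_add_distrib, sum_add_distrib] at h4
    have h7 : #(G.sphere x i) ≤ #(G.sphere x (i + 1)) := by nlinarith
    -- The four units beyond `M` absorb the edges back (`n₀ + n₁ ≤ 2 n₁`), inside (`n₁`), and the
    -- `n₁` share of those forward.
    have arith : ∀ c n₀ n₁ n₂ s₀ s₁ s₂ t₀ t₂ : ℕ, n₀ ≤ n₁ → s₁ ≤ c * n₁ →
        s₂ + t₂ ≤ c * (n₁ + n₂) → t₀ + s₀ ≤ c * (n₀ + n₁) →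
        n₁ * (c * (M + 4)) ≤ s₀ + s₁ + s₂ → c * (M * n₁) ≤ c * n₂ := by
      intro c n₀ n₁ n₂ s₀ s₁ s₂ t₀ t₂ h h1 h2 h3 h4
      have := Nat.mul_le_mul_left c h
      linarith
    have h8 := arith _ _ _ _ _ _ _ _ _ h7 h1 h2 h3 h4
    exact Nat.le_of_mul_le_mul_left h8 (by omega)

open scoped Classical in
theorem pow_le_card_of_free_cycleGraph [Fintype V] [Nonempty V] {G : SimpleGraph V} {k : ℕ} {M : ℕ}
    (hM : 1 ≤ M) (hk : 1 ≤ k) (hG : (cycleGraph (2 * k)).Free G)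
    (hdeg : ∀ v, 2 * (2 * k) * (M + 4) ≤ #{w | G.Adj v w}) : M ^ k ≤ Fintype.card V := by
  obtain ⟨x⟩ := ‹Nonempty V›
  have h : ∀ i ≤ k, M ^ i ≤ #(G.sphere x i) := by
    intro i
    induction i with
    | zero =>
      intro _
      exact card_pos.2 ⟨x, by simp [mem_sphere]⟩
    | succ i ih =>
      intro hi
      rw [pow_succ']
      exact (Nat.mul_le_mul_left _ (ih (by omega))).trans
        (mul_card_sphere_le hM hk hG hdeg x i (by omega))
  exact (h k le_rfl).trans (card_le_univ _)

/-! ### Edge counts without a `2k`-cycle -/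

open scoped Classical in
/-- **Bondy–Simonovits theorem**, for the subgraph induced by a finite set of vertices. -/
theorem sum_card_adj_le_of_free_cycleGraph {G : SimpleGraph V} {k : ℕ} (hk : 1 ≤ k)
    (hG : (cycleGraph (2 * k)).Free G) (S : Finset V) :
    (∑ v ∈ S, #{w ∈ S | G.Adj v w} : ℝ) ≤ 48 * k * (#S : ℝ) ^ (1 + 1 / (k : ℝ)) := by
  rcases S.eq_empty_or_nonempty with rfl | hne
  · simp only [sum_empty]; positivity
  -- Least natural number above the `k`-th root: a core would need `M ^ k > #S` vertices.
  set M : ℕ := ⌊(#S : ℝ) ^ (1 / (k : ℝ))⌋₊ + 1 with hM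
  have hk0 : (k : ℝ) ≠ 0 := by positivity
  have hlt : #S < M ^ k := by
    have h1 : (#S : ℝ) ^ (1 / (k : ℝ)) < M := by rw [hM]; push_cast; exact Nat.lt_floor_add_one _
    have h2 := pow_lt_pow_left₀ h1 (by positivity) (by omega : k ≠ 0)
    rw [← Real.rpow_natCast, ← Real.rpow_mul (by positivity), one_div, inv_mul_cancel₀ hk0,
      Real.rpow_one] at h2
    exact_mod_cast h2
  have h := (exists_core_or_sum_le (r := G.Adj) (fun _ _ h => h.symm) (2 * (2 * k) * (M + 4)) S).resolve_left (by
    rintro ⟨S', hS', hne', hdeg⟩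
    have : Nonempty S' := hne'.to_subtype
    have hle := pow_le_card_of_free_cycleGraph (V := S') (G := G.induce (S' : Set V)) (k := k)
      (M := M) (by omega) hk (fun hc => hG (hc.trans ⟨Copy.induce G _⟩)) (by
        rintro ⟨v, hv⟩
        refine (hdeg v hv).le.trans ?_
        rw [← card_map (Function.Embedding.subtype (· ∈ S'))]
        refine card_le_card fun w hw => ?_
        rw [mem_filter] at hw
        simpa [and_comm] using hw)
    rw [Fintype.card_coe] at hle
    exact absurd (hle.trans (card_le_card hS')) (by omega))
  have hS1 : (1 : ℝ) ≤ #S := by exact_mod_cast hne.card_pos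
  have h1 : (1 : ℝ) ≤ (#S : ℝ) ^ (1 / (k : ℝ)) := Real.one_le_rpow hS1 (by positivity)
  have hMle : (M : ℝ) + 4 ≤ 6 * (#S : ℝ) ^ (1 / (k : ℝ)) := by
    have := Nat.floor_le (show 0 ≤ (#S : ℝ) ^ (1 / (k : ℝ)) by positivity)
    rw [hM]; push_cast; linarith
  calc (∑ v ∈ S, #{w ∈ S | G.Adj v w} : ℝ)
      ≤ 2 * (2 * (2 * k) * (M + 4)) * #S := by exact_mod_cast h
    _ ≤ 2 * (2 * (2 * k) * (6 * (#S : ℝ) ^ (1 / (k : ℝ)))) * #S := by gcongr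
    _ = 48 * k * (#S : ℝ) ^ (1 + 1 / (k : ℝ)) := by
      rw [Real.rpow_add (by linarith), Real.rpow_one]; ring

open scoped Classical in
/-- In a graph without a `2k`-cycle, only few edges meet a small set of vertices. -/
theorem sum_card_neighbors_le_of_free_cycleGraph [Fintype V] {G : SimpleGraph V} {k : ℕ}
    (hk : 1 ≤ k) (hG : (cycleGraph (2 * k)).Free G) (S : Finset V) :
    (∑ v ∈ S, #{w | G.Adj v w} : ℝ) ≤ 384 * k * Fintype.card V * (#S : ℝ) ^ (1 / (k : ℝ)) := by
  rcases S.eq_empty_or_nonempty with rfl | hne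
  · simp only [sum_empty]; positivity
  set s := #S with hs
  have hs0 : 0 < s := hne.card_pos
  set n := Fintype.card V with hn
  have hsn : s ≤ n := card_le_univ S
  let e := Fintype.equivFin V
  -- Cut `V` into blocks of size at most `s`, so each `S ∪ B q` has size at most `2s`; the `n / s +
  -- 1` blocks cost a factor of about `n / s`.
  let B : ℕ → Finset V := fun q => {v | (e v : ℕ) / s = q}
  have hB : ∀ q, #(B q) ≤ s := by
    intro q
    rw [← card_range s]
    refine card_le_card_of_injOn (fun v => (e v : ℕ) % s)
      (fun v _ => mem_coe.2 (mem_range.2 (Nat.mod_lt _ hs0))) ?_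
    intro v hv w hw h
    simp only [B, coe_filter, mem_univ, true_and, Set.mem_ofPred_eq] at hv hw h
    apply e.injective
    apply Fin.ext
    rw [← Nat.div_add_mod (e v : ℕ) s, ← Nat.div_add_mod (e w : ℕ) s, hv, hw, h]
  have hsplit : ∀ v, #{w | G.Adj v w} = ∑ q ∈ range (n / s + 1), #{w ∈ B q | G.Adj v w} := by
    intro v
    rw [card_eq_sum_card_fiberwise (f := fun w => (e w : ℕ) / s) (t := range (n / s + 1))]
    · refine sum_congr rfl fun q _ => congrArg _ ?_
      ext w
      simp [B, and_comm]
    · intro w _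
      rw [mem_coe, mem_range]
      exact Nat.lt_succ_of_le (Nat.div_le_div_right (e w).2.le)
  have hblock : ∀ q, (∑ v ∈ S, #{w ∈ B q | G.Adj v w} : ℝ) ≤
      192 * k * (s * (s : ℝ) ^ (1 / (k : ℝ))) := by
    intro q
    have h1 : (∑ v ∈ S, #{w ∈ B q | G.Adj v w} : ℝ) ≤
        ∑ v ∈ S ∪ B q, (#{w ∈ S ∪ B q | G.Adj v w} : ℝ) := by
      refine (sum_le_sum fun v _ => ?_).trans
        (sum_le_sum_of_subset_of_nonneg subset_union_left fun _ _ _ => by positivity)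
      exact_mod_cast card_le_card (filter_subset_filter _ subset_union_right)
    have hc : (#(S ∪ B q) : ℝ) ≤ 2 * s := by
      have := (card_union_le S (B q)).trans (Nat.add_le_add_left (hB q) _)
      exact_mod_cast (by omega : #(S ∪ B q) ≤ 2 * s)
    have hk1 : 1 / (k : ℝ) ≤ 1 := by
      rw [div_le_one (by positivity)]; exact_mod_cast hk
    calc (∑ v ∈ S, #{w ∈ B q | G.Adj v w} : ℝ)
        ≤ 48 * k * (#(S ∪ B q) : ℝ) ^ (1 + 1 / (k : ℝ)) :=
          h1.trans (sum_card_adj_le_of_free_cycleGraph hk hG _)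
      _ ≤ 48 * k * (2 * s : ℝ) ^ (1 + 1 / (k : ℝ)) := by gcongr
      _ = 48 * k * (2 ^ (1 + 1 / (k : ℝ)) * (s * (s : ℝ) ^ (1 / (k : ℝ)))) := by
          rw [Real.mul_rpow (by norm_num) (by positivity),
            Real.rpow_add (x := (s : ℝ)) (by positivity), Real.rpow_one]
      _ ≤ 48 * k * (2 ^ (2 : ℝ) * (s * (s : ℝ) ^ (1 / (k : ℝ)))) := by
          gcongr
          · norm_num
          · linarith
      _ = _ := by norm_num; ring
  have hq : ((n / s + 1 : ℕ) : ℝ) * s ≤ 2 * n := by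
    have := Nat.div_mul_le_self n s
    exact_mod_cast (by rw [add_mul]; omega : (n / s + 1) * s ≤ 2 * n)
  calc (∑ v ∈ S, #{w | G.Adj v w} : ℝ)
      = ∑ q ∈ range (n / s + 1), ∑ v ∈ S, (#{w ∈ B q | G.Adj v w} : ℝ) := by
        rw [sum_comm]
        exact sum_congr rfl fun v _ => by rw [hsplit]; push_cast; rfl
    _ ≤ ∑ q ∈ range (n / s + 1), 192 * k * (s * (s : ℝ) ^ (1 / (k : ℝ))) :=
        sum_le_sum fun q _ => hblock q
    _ = 192 * k * ((((n / s + 1 : ℕ) : ℝ) * s) * (s : ℝ) ^ (1 / (k : ℝ))) := by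
        rw [sum_const, card_range, nsmul_eq_mul]; ring
    _ ≤ 192 * k * ((2 * n) * (s : ℝ) ^ (1 / (k : ℝ))) := by gcongr
    _ = _ := by ring

/-! ### Links and ordered triangles -/

/-- The link of a vertex `a`: the edges that form a triangle with `a`. -/
def link (G : SimpleGraph V) (a : V) : SimpleGraph V where
  Adj b c := G.Adj a b ∧ G.Adj a c ∧ G.Adj b c
  symm := ⟨fun _ _ h => ⟨h.2.1, h.1, h.2.2.symm⟩⟩
  loopless := ⟨fun _ h => G.irrefl h.2.2⟩

theorem link_adj {G : SimpleGraph V} {a b c : V} :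
    (G.link a).Adj b c ↔ G.Adj a b ∧ G.Adj a c ∧ G.Adj b c := Iff.rfl

/-- Links live on all of `V`, so a vertex of `H` is forced into the neighbourhood of `a` only by
having a neighbour in `H`. -/
theorem free_link {W : Type*} {H : SimpleGraph W} (hH : ∀ u, ∃ v, H.Adj u v) {G : SimpleGraph V}
    (hG : H.suspension.Free G) (a : V) : H.Free (G.link a) := by
  rintro ⟨f⟩
  have ha : ∀ u, G.Adj a (f u) := fun u => by
    obtain ⟨v, hv⟩ := hH u
    exact (link_adj.1 (f.toHom.map_adj hv)).1
  refine hG ⟨⟨⟨fun u => u.elim a f, ?_⟩, ?_⟩⟩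
  · rintro (_ | u) (_ | v) h
    · exact h.elim
    · exact ha v
    · exact (ha u).symm
    · exact (link_adj.1 (f.toHom.map_adj h)).2.2
  · rintro (_ | u) (_ | v) h
    · rfl
    · exact absurd (ha v) (by rw [show f v = a from h.symm]; exact G.irrefl)
    · exact absurd (ha u) (by rw [show f u = a from h]; exact G.irrefl)
    · exact congrArg some (f.injective h)

theorem exists_adj_cycleGraph {n : ℕ} (hn : 2 ≤ n) (u : Fin n) :
    ∃ v, (cycleGraph n).Adj u v := by
  obtain ⟨m, rfl⟩ : ∃ m, n = m + 2 := ⟨n - 2, by omega⟩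
  exact ⟨u + 1, by simp [cycleGraph_adj]⟩

open scoped Classical in
/-- The ordered triangles of a graph. -/
noncomputable def orderedTriangles [Fintype V] (G : SimpleGraph V) : Finset (V × V × V) :=
  {t | G.Adj t.1 t.2.1 ∧ G.Adj t.1 t.2.2 ∧ G.Adj t.2.1 t.2.2}

theorem mem_orderedTriangles [Fintype V] {G : SimpleGraph V} {a b c : V} :
    (a, b, c) ∈ G.orderedTriangles ↔ G.Adj a b ∧ G.Adj a c ∧ G.Adj b c := by
  simp [orderedTriangles]

theorem labelledCopyCount_le_card_of_injective {W β : Type*} [Fintype V] [Fintype W] [Fintype β]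
    {G : SimpleGraph V} {H : SimpleGraph W} (f : Copy H G → β) (hf : Function.Injective f) :
    G.labelledCopyCount H ≤ Fintype.card β := by
  classical
  unfold labelledCopyCount
  exact Fintype.card_le_of_injective f hf

theorem copyCount_completeGraph_three_le [Fintype V] (G : SimpleGraph V) :
    G.copyCount (completeGraph (Fin 3)) ≤ #G.orderedTriangles := by
  have h : ∀ (f : Copy (completeGraph (Fin 3)) G) (i j : Fin 3), i ≠ j → G.Adj (f i) (f j) :=
    fun f i j hij => f.toHom.map_adj hij
  rw [← Fintype.card_coe]
  refine copyCount_le_labelledCopyCount.trans (labelledCopyCount_le_card_of_injective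
    (fun f => ⟨(f 0, f 1, f 2), mem_orderedTriangles.2
      ⟨h f 0 1 (by decide), h f 0 2 (by decide), h f 1 2 (by decide)⟩⟩) ?_)
  intro f g hfg
  simp only [Subtype.mk.injEq, Prod.mk.injEq] at hfg
  ext i
  fin_cases i
  exacts [hfg.1, hfg.2.1, hfg.2.2]

theorem card_cliqueFinset_three_le [Fintype V] [DecidableEq V] (G : SimpleGraph V)
    [DecidableRel G.Adj] : #(G.cliqueFinset 3) ≤ #G.orderedTriangles := by
  refine (card_le_card ?_).trans (card_image_le (f := fun t : V × V × V => {t.1, t.2.1, t.2.2}))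
  intro s hs
  rw [mem_cliqueFinset_iff, is3Clique_iff] at hs
  obtain ⟨a, b, c, hab, hac, hbc, rfl⟩ := hs
  exact mem_image.2 ⟨(a, b, c), mem_orderedTriangles.2 ⟨hab, hac, hbc⟩, rfl⟩

open scoped Classical in
theorem card_orderedTriangles_filter [Fintype V] (G : SimpleGraph V) (S : V → Finset V) :
    #{t ∈ G.orderedTriangles | t.2.1 ∈ S t.1} = ∑ a, ∑ b ∈ S a, #{c | (G.link a).Adj b c} := by
  simp_rw [← card_sigma]
  refine card_bij' (fun t _ => ⟨t.1, t.2.1, t.2.2⟩) (fun t _ => (t.1, t.2.1, t.2.2)) ?_ ?_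
    (fun _ _ => rfl) (fun _ _ => rfl)
  · rintro ⟨a, b, c⟩ h
    rw [mem_filter, mem_orderedTriangles] at h
    simpa [link_adj] using ⟨h.2, h.1⟩
  · rintro ⟨a, b, c⟩ h
    rw [mem_filter, mem_orderedTriangles]
    simpa [link_adj, and_comm] using h

open scoped Classical in
/-- If `H` is triangle-free, every triangle of `G` has an edge outside `H`. -/
theorem card_orderedTriangles_le_of_cliqueFree [Fintype V] (G H : SimpleGraph V)
    (hH : H.CliqueFree 3) (F : V → Finset V) (hF : ∀ a b, b ∈ F a ↔ (G \ H).Adj a b) :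
    #G.orderedTriangles ≤ 3 * #{t ∈ G.orderedTriangles | t.2.1 ∈ F t.1} := by
  have hsub : G.orderedTriangles ⊆ {t ∈ G.orderedTriangles | t.2.1 ∈ F t.1} ∪
      {t ∈ G.orderedTriangles | t.2.2 ∈ F t.1} ∪ {t ∈ G.orderedTriangles | t.2.2 ∈ F t.2.1} := by
    rintro ⟨a, b, c⟩ h
    by_contra hcon
    simp only [mem_union, mem_filter, h, true_and, hF, sdiff_adj] at hcon
    rw [mem_orderedTriangles] at h
    simp only [h, true_and, not_or, not_not] at hcon
    exact hH {a, b, c} (is3Clique_iff.2 ⟨a, b, c, hcon.1.1, hcon.1.2, hcon.2, rfl⟩)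
  have h1 : #{t ∈ G.orderedTriangles | t.2.2 ∈ F t.1} ≤
      #{t ∈ G.orderedTriangles | t.2.1 ∈ F t.1} := by
    refine card_le_card_of_injOn (fun t => (t.1, t.2.2, t.2.1)) ?_ ?_
    · rintro ⟨a, b, c⟩ h
      simp only [mem_coe, mem_filter, mem_orderedTriangles] at h ⊢
      exact ⟨⟨h.1.2.1, h.1.1, h.1.2.2.symm⟩, h.2⟩
    · rintro ⟨a, b, c⟩ _ ⟨a', b', c'⟩ _ h
      simp_all
  have h2 : #{t ∈ G.orderedTriangles | t.2.2 ∈ F t.2.1} ≤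
      #{t ∈ G.orderedTriangles | t.2.1 ∈ F t.1} := by
    refine card_le_card_of_injOn (fun t => (t.2.1, t.2.2, t.1)) ?_ ?_
    · rintro ⟨a, b, c⟩ h
      simp only [mem_coe, mem_filter, mem_orderedTriangles] at h ⊢
      exact ⟨⟨h.1.2.2, h.1.1.symm, h.1.2.1.symm⟩, h.2⟩
    · rintro ⟨a, b, c⟩ _ ⟨a', b', c'⟩ _ h
      simp_all
  have := (card_le_card hsub).trans
    ((card_union_le _ _).trans (Nat.add_le_add_right (card_union_le _ _) _))
  omega

open scoped Classical in
theorem card_filter_orderedTriangles_le [Fintype V] {G : SimpleGraph V} {k : ℕ} (hk : 1 ≤ k)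
    (hG : (suspension (cycleGraph (2 * k))).Free G) (S : V → Finset V) :
    (#{t ∈ G.orderedTriangles | t.2.1 ∈ S t.1} : ℝ) ≤
      384 * k * Fintype.card V * ∑ a, (#(S a) : ℝ) ^ (1 / (k : ℝ)) := by
  rw [card_orderedTriangles_filter, mul_sum]
  push_cast
  exact sum_le_sum fun a _ => sum_card_neighbors_le_of_free_cycleGraph hk
    (free_link (exists_adj_cycleGraph (by omega)) hG a) (S a)

theorem card_orderedTriangles_le [Fintype V] {G : SimpleGraph V} {k : ℕ} (hk : 1 ≤ k)
    (hG : (suspension (cycleGraph (2 * k))).Free G) :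
    (#G.orderedTriangles : ℝ) ≤
      384 * k * (Fintype.card V : ℝ) ^ 2 * (Fintype.card V : ℝ) ^ (1 / (k : ℝ)) := by
  classical
  have h := card_filter_orderedTriangles_le hk hG fun _ => univ
  simp only [mem_univ, filter_true, card_univ, sum_const, nsmul_eq_mul] at h
  calc _ ≤ _ := h
    _ = _ := by ring

/-! ### Triangle removal and the power mean -/

open scoped Classical in
theorem sum_card_sdiff_adj [Fintype V] {G H : SimpleGraph V} [DecidableRel G.Adj]
    [DecidableRel H.Adj] (hH : H ≤ G) :
    (∑ a, #{b | (G \ H).Adj a b} : ℝ) = 2 * (#G.edgeFinset - #H.edgeFinset : ℝ) := by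
  have hG2 := G.sum_degrees_eq_twice_card_edges
  have hH2 := H.sum_degrees_eq_twice_card_edges
  rw [mul_sub]
  have e1 : (2 * #G.edgeFinset : ℝ) = ∑ a, (G.degree a : ℝ) := by exact_mod_cast hG2.symm
  have e2 : (2 * #H.edgeFinset : ℝ) = ∑ a, (H.degree a : ℝ) := by exact_mod_cast hH2.symm
  rw [e1, e2, ← sum_sub_distrib]
  refine sum_congr rfl fun a _ => ?_
  rw [eq_sub_iff_add_eq, ← card_neighborFinset_eq_degree, ← card_neighborFinset_eq_degree]
  norm_cast
  rw [← card_union_of_disjoint]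
  · congr 1
    ext b
    have := @hH a b
    simp only [mem_union, mem_filter, mem_univ, true_and, sdiff_adj, mem_neighborFinset]
    tauto
  · rw [Finset.disjoint_left]
    intro b hb
    simp only [mem_filter, mem_univ, true_and, sdiff_adj] at hb
    simpa using hb.2

theorem sum_rpow_one_div_le [Fintype V] {k : ℕ} (hk : 1 ≤ k) {δ : ℝ} (hδ : 0 ≤ δ) (f : V → ℝ)
    (hf : ∀ a, 0 ≤ f a) (hsum : ∑ a, f a ≤ δ ^ k * (Fintype.card V : ℝ) ^ 2) :
    ∑ a, f a ^ (1 / (k : ℝ)) ≤ δ * (Fintype.card V * (Fintype.card V : ℝ) ^ (1 / (k : ℝ))) := by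
  rcases isEmpty_or_nonempty V with hV | hV
  · simp
  obtain ⟨m, rfl⟩ : ∃ m, k = m + 1 := ⟨k - 1, by omega⟩
  have hm : ((m + 1 : ℕ) : ℝ) ≠ 0 := by positivity
  have hn : (0 : ℝ) < Fintype.card V := by exact_mod_cast Fintype.card_pos
  have hroot : ∀ y : ℝ, 0 ≤ y → (y ^ (1 / ((m + 1 : ℕ) : ℝ))) ^ (m + 1) = y := by
    intro y hy
    rw [← Real.rpow_natCast, ← Real.rpow_mul hy, one_div, inv_mul_cancel₀ hm, Real.rpow_one]
  refine le_of_pow_le_pow_left₀ (Nat.succ_ne_zero m) (by positivity) ?_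
  have h := pow_sum_div_card_le_sum_pow (s := univ) (f := fun a => f a ^ (1 / ((m + 1 : ℕ) : ℝ)))
    (fun a _ => Real.rpow_nonneg (hf a) _) m
  rw [card_univ, div_le_iff₀ (by positivity), sum_congr rfl fun a _ => hroot _ (hf a)] at h
  calc _ ≤ _ := h
    _ ≤ δ ^ (m + 1) * (Fintype.card V : ℝ) ^ 2 * (Fintype.card V : ℝ) ^ m := by gcongr
    _ = _ := by rw [mul_pow, mul_pow, hroot _ hn.le, Nat.succ_eq_add_one]; ring

theorem card_orderedTriangles_le_of_lt_triangleRemovalBound [Fintype V] {G : SimpleGraph V} {k : ℕ}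
    (hk : 1 ≤ k) (hG : (suspension (cycleGraph (2 * k))).Free G) {δ : ℝ} (hδ : 0 ≤ δ)
    (hlt : (#G.orderedTriangles : ℝ) <
      triangleRemovalBound (δ ^ k / 2) * (Fintype.card V : ℝ) ^ 3) :
    (#G.orderedTriangles : ℝ) ≤ 1152 * k * δ *
      ((Fintype.card V : ℝ) ^ 2 * (Fintype.card V : ℝ) ^ (1 / (k : ℝ))) := by
  classical
  -- The half cancels the double counting of deleted edges; the power `k` becomes a factor `δ` after
  -- taking roots.
  obtain ⟨H, hHG, _, hcard, hH⟩ := triangle_removal (G := G) (ε := δ ^ k / 2)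
    (lt_of_le_of_lt (by exact_mod_cast G.card_cliqueFinset_three_le) hlt)
  let F : V → Finset V := fun a => {b | (G \ H).Adj a b}
  have h1 := card_orderedTriangles_le_of_cliqueFree G H hH F fun a b => by simp [F]
  have h2 := card_filter_orderedTriangles_le hk hG F
  have h3 := sum_card_sdiff_adj hHG
  have h4 := sum_rpow_one_div_le hk hδ (fun a => (#{b | (G \ H).Adj a b} : ℝ))
    (fun a => by positivity) (by
      push_cast at hcard h3 ⊢
      linarith)
  calc (#G.orderedTriangles : ℝ)
      ≤ 3 * #{t ∈ G.orderedTriangles | t.2.1 ∈ F t.1} := by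
        exact_mod_cast h1
    _ ≤ 3 * (384 * k * Fintype.card V *
        (δ * (Fintype.card V * (Fintype.card V : ℝ) ^ (1 / (k : ℝ))))) := by
        gcongr
        exact h2.trans (by gcongr)
    _ = _ := by ring

theorem eventually_mul_lt_mul_cube {k : ℕ} (hk : 2 ≤ k) (C : ℝ) {η : ℝ} (hη : 0 < η) :
    ∀ᶠ n : ℕ in atTop, C * (n : ℝ) ^ 2 * (n : ℝ) ^ (1 / (k : ℝ)) < η * (n : ℝ) ^ 3 := by
  have hk1 : 1 / (k : ℝ) < 1 := by
    rw [div_lt_one (by positivity)]; exact_mod_cast hk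
  have h := ((tendsto_rpow_neg_atTop (sub_pos.2 hk1)).comp
    tendsto_natCast_atTop_atTop).const_mul C
  rw [mul_zero] at h
  filter_upwards [h.eventually_lt_const hη, eventually_gt_atTop 0] with n hn hn0
  have hn0 : (0 : ℝ) < n := by exact_mod_cast hn0
  have e : (n : ℝ) ^ (1 / (k : ℝ)) = (n : ℝ) ^ (-(1 - 1 / (k : ℝ))) * n := by
    rw [← Real.rpow_add_one hn0.ne']
    congr 1; ring
  rw [e]
  calc _ = C * (n : ℝ) ^ (-(1 - 1 / (k : ℝ))) * (n : ℝ) ^ 3 := by ring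
    _ < _ := by gcongr; exact hn

end SimpleGraph

/-- For every fixed `k ≥ 2`, `ex(n, K₃, Ĉ₂ₖ) = o(n ^ (2 + 1/k))` as `n → ∞`. -/
theorem theorem2 (k : ℕ) (hk : 2 ≤ k) :
    (fun n : ℕ => (SimpleGraph.generalizedTuranNumber n (SimpleGraph.completeGraph (Fin 3))
        (SimpleGraph.suspension (SimpleGraph.cycleGraph (2 * k))) : ℝ))
      =o[atTop] fun n : ℕ => (n : ℝ) ^ (2 + 1 / (k : ℝ)) := by
  classical
  rw [isLittleO_iff]
  intro c hc
  have hk0 : (0 : ℝ) < k := by positivity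
  set δ : ℝ := c / (1152 * k) with hδ
  have hδ0 : 0 < δ := by positivity
  have hη := SimpleGraph.triangleRemovalBound_pos (show 0 < δ ^ k / 2 by positivity)
  filter_upwards [SimpleGraph.eventually_mul_lt_mul_cube hk (384 * k) hη, eventually_gt_atTop 0]
    with n hn hn0
  have hn0 : (0 : ℝ) < n := by exact_mod_cast hn0
  -- The maximum is a supremum in `ℕ`, so the real bound is replaced by its floor.
  rw [Real.norm_of_nonneg (by positivity), Real.norm_of_nonneg (by positivity),
    ← Nat.le_floor_iff (by positivity)]
  refine Finset.sup_le fun G hG => Nat.le_floor ?_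
  have hG := (Finset.mem_filter.1 hG).2
  have h1 := SimpleGraph.card_orderedTriangles_le (by omega) hG
  have h2 := SimpleGraph.card_orderedTriangles_le_of_lt_triangleRemovalBound (by omega) hG hδ0.le
    (h1.trans_lt (by rwa [Fintype.card_fin]))
  rw [Fintype.card_fin] at h2
  calc (G.copyCount (SimpleGraph.completeGraph (Fin 3)) : ℝ) ≤ G.orderedTriangles.card := by
        exact_mod_cast G.copyCount_completeGraph_three_le
    _ ≤ _ := h2
    _ = c * (n : ℝ) ^ (2 + 1 / (k : ℝ)) := by
        rw [Real.rpow_add hn0, Real.rpow_two, hδ]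
        field_simp
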